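/- Let $\mathcal H$ be a finite-dimensional complex Hilbert space, let $A_1,\dots,A_r$ be positive semidefinite operators on $\mathcal H$, and let $A_0:=\sum_{i=1}^r A_i$. Let $$\Gamma^*:=\inf\Big\{\operatorname{Tr}A_0-\sum_{k=1}^r\|X_kA_k\|_1 \;:\; X_1,\dots,X_r\in\mathcal B(\mathcal H),\ \sum_{k=1}^r X_k^*X_k=I\Big\}$$ (Tyson's quantity), where $\|X\|_1=\operatorname{Tr}(X^*X)^{1/2}$ is the trace norm. Then $$\Gamma^*\le \operatorname{Tr}A_0-\operatorname{Tr}\Big(\sum_{j}A_j^2\Big)^{1/2}\le \operatorname{Tr}A_0-(\operatorname{Tr}A_0)^{3/2}\Big(\operatorname{Tr}A_0+2\sum_{(i,j):\,i<j}\operatorname{Tr}A_i^{1/2}A_j^{1/2}\Big)^{-1/2}\le\sum_{(i,j):\,i<j}\operatorname{Tr}A_i^{1/2}A_j^{1/2}.$$ Powers of positive semidefinite operators are taken on their support, and likewise $0^{-1/2}:=0$, so that all terms are $0$ if every $A_i$ is $0$. -/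

import Mathlib

/-- The (real part of the) trace of an operator on a finite-dimensional complex Hilbert space.
It is applied below only to operators whose trace is a real number. -/
noncomputable def opTr {H : Type*} [NormedAddCommGroup H] [InnerProductSpace ℂ H]
    (A : H →L[ℂ] H) : ℝ :=
  (LinearMap.trace ℂ H (A : H →ₗ[ℂ] H)).re

/-- The trace norm `‖X‖₁ = Tr |X|`, where `|X|` is the square root of `X* X`. -/
noncomputable def traceNorm {H : Type*} [NormedAddCommGroup H] [InnerProductSpace ℂ H]
    [CompleteSpace H] (X : H →L[ℂ] H) : ℝ :=
  opTr (CFC.abs X)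

/-- `Γ({X_k}) = Tr A₀ - ∑ₖ ‖X_k A_k‖₁`, where `A₀ = ∑ₖ A_k`. -/
noncomputable def tysonGamma {H : Type*} [NormedAddCommGroup H] [InnerProductSpace ℂ H]
    [CompleteSpace H] {r : ℕ} (A X : Fin r → H →L[ℂ] H) : ℝ :=
  opTr (∑ k, A k) - ∑ k, traceNorm (X k * A k)

/-- Tyson's quantity `Γ*`: the infimum of `Γ({X_k})` over all families of operators
`X_1, …, X_r` with `∑ₖ X_k* X_k = I`. -/
noncomputable def tysonGammaStar {H : Type*} [NormedAddCommGroup H] [InnerProductSpace ℂ H]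
    [CompleteSpace H] {r : ℕ} (A : Fin r → H →L[ℂ] H) : ℝ :=
  sInf {g : ℝ | ∃ X : Fin r → H →L[ℂ] H, ∑ k, star (X k) * X k = 1 ∧ g = tysonGamma A X}

/-- The sum of the pairwise overlaps, `∑_{(i,j) : i < j} Tr A_i^{1/2} A_j^{1/2}`. The powers of
operators are those of the continuous functional calculus. -/
noncomputable def pairOverlap {H : Type*} [NormedAddCommGroup H] [InnerProductSpace ℂ H]
    [CompleteSpace H] {r : ℕ} (A : Fin r → H →L[ℂ] H) : ℝ :=
  ∑ i, ∑ j ∈ Finset.Ioi i, opTr (A i ^ (1 / 2 : ℝ) * A j ^ (1 / 2 : ℝ))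

/-! Write `S = (∑ A_j²)^{1/2}` and `E = ∑ A_i^{1/2}`; inverses are taken on supports.

First bound: test with `X_k = A_k S⁻¹`, corrected on `ker S`. Then `X_k A_k = A_k S⁻¹ A_k` is
positive, and the trace norms add up to `Tr S² S⁻¹ = Tr S` (`tysonGammaStar_le`).

Second bound: since `Tr E² = Tr A₀ + 2 ∑_{i<j} Tr A_i^{1/2} A_j^{1/2}`, it amounts to `(Tr A₀)³ ≤
(Tr S)² Tr E²` (`pow_three_sum_opTr_le`). The four numbers `F₁ = ∑ Tr A_i^{5/4} E^{-1/2}`, `F₀ = Tr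
A₀`, `F₂ = ∑ Tr A_i^{3/4} E^{1/2}`, `K = Tr E²` are log-convex in this order: Cauchy–Schwarz gives
`F₀² ≤ F₁ F₂` and `F₂² ≤ F₀ K`, hence `F₀³ ≤ F₁² K`. Finally `F₁ ≤ Tr S` by duality, as the
`A_i^{1/4} E^{-1/2}` form a column contraction.

The third bound is an inequality between real numbers. -/

/-! ### Trace inequalities of Cauchy–Schwarz type. -/

section OperatorTrace

variable {H : Type*} [NormedAddCommGroup H] [InnerProductSpace ℂ H]

theorem opTr_zero : opTr (0 : H →L[ℂ] H) = 0 := by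
  simp [opTr]

theorem opTr_sub (A B : H →L[ℂ] H) : opTr (A - B) = opTr A - opTr B := by
  simp [opTr]

theorem opTr_sum {ι : Type*} (s : Finset ι) (A : ι → H →L[ℂ] H) :
    opTr (∑ i ∈ s, A i) = ∑ i ∈ s, opTr (A i) := by
  simp [opTr]

theorem opTr_smul (t : ℝ) (A : H →L[ℂ] H) : opTr (t • A) = t * opTr A := by
  have : (((t • A : H →L[ℂ] H)) : H →ₗ[ℂ] H) = (t : ℂ) • (A : H →ₗ[ℂ] H) := by
    ext x; simp
  simp [opTr, this]

theorem opTr_mul_comm (A B : H →L[ℂ] H) : opTr (A * B) = opTr (B * A) := by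
  have := LinearMap.trace_mul_comm ℂ (A : H →ₗ[ℂ] H) (B : H →ₗ[ℂ] H)
  simp only [opTr]
  exact congrArg Complex.re this

theorem opTr_nonneg [FiniteDimensional ℂ H] {A : H →L[ℂ] H} (hA : 0 ≤ A) : 0 ≤ opTr A := by
  have h := ((ContinuousLinearMap.nonneg_iff_isPositive A).1 hA).toLinearMap.trace_nonneg
  exact (Complex.le_def.1 h).1

theorem opTr_mono [FiniteDimensional ℂ H] {A B : H →L[ℂ] H} (h : A ≤ B) : opTr A ≤ opTr B := by
  have := opTr_nonneg (sub_nonneg.2 h)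
  rw [opTr_sub] at this
  linarith

variable [FiniteDimensional ℂ H] [CompleteSpace H]

theorem opTr_star (A : H →L[ℂ] H) : opTr (star A) = opTr A := by
  have b := stdOrthonormalBasis ℂ H
  simp only [opTr, LinearMap.trace_eq_sum_inner _ b, Complex.re_sum]
  refine Finset.sum_congr rfl fun i _ => ?_
  rw [ContinuousLinearMap.star_eq_adjoint]
  simp only [ContinuousLinearMap.coe_coe]
  rw [ContinuousLinearMap.adjoint_inner_right]
  exact inner_re_symm (𝕜 := ℂ) _ _

/-- The Cauchy–Schwarz inequality for the Hilbert–Schmidt inner product, linearized. -/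
theorem two_mul_sum_opTr_star_mul_le {ι : Type*} (s : Finset ι) (X Y : ι → H →L[ℂ] H) :
    2 * ∑ i ∈ s, opTr (star (X i) * Y i) ≤
      ∑ i ∈ s, opTr (star (X i) * X i) + ∑ i ∈ s, opTr (star (Y i) * Y i) := by
  rw [Finset.mul_sum, ← Finset.sum_add_distrib]
  refine Finset.sum_le_sum fun i _ => ?_
  have h := opTr_nonneg (star_mul_self_nonneg (X i - Y i))
  have h2 := opTr_star (star (X i) * Y i)
  simp only [star_sub, sub_mul, mul_sub, opTr_sub, star_mul, star_star] at h h2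
  linarith

/-- The Cauchy–Schwarz inequality for the Hilbert–Schmidt inner product. -/
theorem sq_sum_opTr_star_mul_le {ι : Type*} (s : Finset ι) (X Y : ι → H →L[ℂ] H) :
    (∑ i ∈ s, opTr (star (X i) * Y i)) ^ 2 ≤
      (∑ i ∈ s, opTr (star (X i) * X i)) * ∑ i ∈ s, opTr (star (Y i) * Y i) := by
  have key : ∀ t : ℝ, 0 ≤ (∑ i ∈ s, opTr (star (X i) * X i)) * (t * t) +
      (-2 * ∑ i ∈ s, opTr (star (X i) * Y i)) * t + ∑ i ∈ s, opTr (star (Y i) * Y i) := by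
    intro t
    have h := two_mul_sum_opTr_star_mul_le s (fun i => t • X i) Y
    simp only [star_smul, star_trivial, smul_mul_assoc, mul_smul_comm, opTr_smul,
      ← Finset.mul_sum] at h
    linarith
  have := discrim_le_zero key
  rw [discrim] at this
  linarith

theorem opTr_mul_nonneg {A B : H →L[ℂ] H} (hA : 0 ≤ A) (hB : 0 ≤ B) : 0 ≤ opTr (A * B) := by
  have hs := (CFC.sqrt_nonneg A).isSelfAdjoint
  rw [← CFC.sqrt_mul_sqrt_self A, mul_assoc, opTr_mul_comm]
  exact opTr_nonneg (hs.conjugate_nonneg hB)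

end OperatorTrace

/-! ### Inverses on the support. -/

section PseudoInverse

variable {H : Type*} [NormedAddCommGroup H] [InnerProductSpace ℂ H] [FiniteDimensional ℂ H]

theorem ContinuousLinearMap.finite_real_spectrum (T : H →L[ℂ] H) : (spectrum ℝ T).Finite := by
  have h : (spectrum ℂ T).Finite := by
    have h2 : spectrum ℂ T = spectrum ℂ (T : H →ₗ[ℂ] H) :=
      AlgEquiv.spectrum_eq (Module.End.toContinuousLinearMap (𝕜 := ℂ) H) (T : H →ₗ[ℂ] H)
    rw [h2]
    exact Module.End.finite_spectrum _
  exact h.preimage (FaithfulSMul.algebraMap_injective ℝ ℂ).injOn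

variable [CompleteSpace H]

theorem ContinuousLinearMap.exists_pseudoinverse {T : H →L[ℂ] H} (hT : 0 ≤ T) :
    ∃ f : H →L[ℂ] H, 0 ≤ f ∧ f * T = T * f ∧ T * f * T = T := by
  -- The spectrum is finite, so even `x⁻¹` with `0⁻¹ = 0` is continuous on it.
  have hc : ∀ g : ℝ → ℝ, ContinuousOn g (spectrum ℝ T) := fun g =>
    T.finite_real_spectrum.continuousOn g
  refine ⟨cfc (fun x : ℝ => x⁻¹) T, ?_, ?_, ?_⟩
  · exact cfc_nonneg fun x hx => inv_nonneg.2 (spectrum_nonneg_of_nonneg hT hx)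
  · have h := (cfc_commute_cfc (fun x : ℝ => x⁻¹) id T).eq
    rwa [cfc_id ℝ T] at h
  · nth_rewrite 1 [← cfc_id ℝ T]
    nth_rewrite 3 [← cfc_id ℝ T]
    rw [← cfc_mul _ _ T (hc _) (hc _), ← cfc_mul _ _ T (hc _) (hc _)]
    conv_rhs => rw [← cfc_id ℝ T]
    refine cfc_congr fun x _ => ?_
    simp

end PseudoInverse

/-! ### Support projections. -/

section SupportProjection

variable {H : Type*} [NormedAddCommGroup H] [InnerProductSpace ℂ H] [CompleteSpace H]

/-- Compressing by `Q` gives positive terms with sum zero. With `Q` the projection onto the kernel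
of the sum, this shows that each `Y i` lives on the support of the sum. -/
theorem mul_eq_zero_of_sum_star_mul_self_mul_eq_zero {ι : Type*} [Fintype ι]
    {Y : ι → H →L[ℂ] H} {Q : H →L[ℂ] H} (h : (∑ i, star (Y i) * Y i) * Q = 0) (i : ι) :
    Y i * Q = 0 := by
  have h2 : ∑ i, star (Y i * Q) * (Y i * Q) = 0 := by
    have : ∑ i, star (Y i * Q) * (Y i * Q) = star Q * ((∑ i, star (Y i) * Y i) * Q) := by
      simp only [Finset.sum_mul, Finset.mul_sum, star_mul, mul_assoc]
    rw [this, h, mul_zero]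
  rw [Finset.sum_eq_zero_iff_of_nonneg fun i _ => star_mul_self_nonneg _] at h2
  exact CStarRing.star_mul_self_eq_zero_iff _ |>.1 (h2 i (Finset.mem_univ i))

theorem IsSelfAdjoint.mul_pseudoinverse_isStarProjection {T f : H →L[ℂ] H}
    (hT : IsSelfAdjoint T) (hf : IsSelfAdjoint f) (hc : f * T = T * f) (hTfT : T * f * T = T) :
    IsStarProjection (T * f) where
  isIdempotentElem := by rw [IsIdempotentElem, ← mul_assoc, hTfT]
  isSelfAdjoint := by rw [IsSelfAdjoint, star_mul, hT.star_eq, hf.star_eq, hc]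

end SupportProjection

/-! ### Roots of positive operators and the expansion of `Tr E²`. -/

section Rpow

variable {H : Type*} [NormedAddCommGroup H] [InnerProductSpace ℂ H] [CompleteSpace H]

theorem rpow_one_div_pow {A : H →L[ℂ] H} (hA : 0 ≤ A) {n : ℕ} (hn : n ≠ 0) :
    (A ^ (1 / n : ℝ)) ^ n = A := by
  rw [← CFC.rpow_natCast _ _ CFC.rpow_nonneg,
    CFC.rpow_rpow_of_exponent_nonneg _ _ _ (by positivity) (by positivity)]
  rw [one_div_mul_cancel (by exact_mod_cast hn), CFC.rpow_one A]

theorem opTr_sq_sum_rpow_half {r : ℕ} {A : Fin r → H →L[ℂ] H} (hA : ∀ i, 0 ≤ A i) :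
    opTr ((∑ i, A i ^ (1 / 2 : ℝ)) * ∑ i, A i ^ (1 / 2 : ℝ)) =
      opTr (∑ i, A i) + 2 * pairOverlap A := by
  have hd : ∀ i, opTr (A i ^ (1 / 2 : ℝ) * A i ^ (1 / 2 : ℝ)) = opTr (A i) := fun i => by
    have := rpow_one_div_pow (hA i) two_ne_zero
    rw [pow_two] at this
    exact_mod_cast congrArg opTr this
  have h := Finset.sum_sum_Ioi_add_eq_sum_sum_off_diag
    (fun j i => opTr (A i ^ (1 / 2 : ℝ) * A j ^ (1 / 2 : ℝ)))
  have h2 : ∀ i, ∑ j, opTr (A i ^ (1 / 2 : ℝ) * A j ^ (1 / 2 : ℝ)) =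
      opTr (A i) + ∑ j ∈ {i}ᶜ, opTr (A i ^ (1 / 2 : ℝ) * A j ^ (1 / 2 : ℝ)) := fun i => by
    rw [← Finset.sum_add_sum_compl {i}, Finset.sum_singleton, hd]
  have h3 : ∀ i j, opTr (A i ^ (1 / 2 : ℝ) * A j ^ (1 / 2 : ℝ)) +
      opTr (A j ^ (1 / 2 : ℝ) * A i ^ (1 / 2 : ℝ)) =
      2 * opTr (A i ^ (1 / 2 : ℝ) * A j ^ (1 / 2 : ℝ)) := fun i j => by
    rw [opTr_mul_comm (A j ^ (1 / 2 : ℝ)), two_mul]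
  rw [Finset.sum_mul_sum]
  simp only [opTr_sum, h2, Finset.sum_add_distrib, pairOverlap, Finset.mul_sum]
  rw [← h]
  simp only [h3]

end Rpow

/-! ### The operator inequalities. -/

section Tyson

variable {H : Type*} [NormedAddCommGroup H] [InnerProductSpace ℂ H] [FiniteDimensional ℂ H]
  [CompleteSpace H]

/-- The trace of the modulus of a column of operators bounds its pairing with every column
contraction. -/
theorem sum_opTr_star_mul_le_opTr_of_sum_star_mul_self_le_one {ι : Type*} [Fintype ι]
    {A X : ι → H →L[ℂ] H} {S : H →L[ℂ] H} (hS : 0 ≤ S) (hSA : ∑ i, star (A i) * A i = S * S)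
    (hX : ∑ i, star (X i) * X i ≤ 1) : ∑ i, opTr (star (X i) * A i) ≤ opTr S := by
  have hs0 := CFC.sqrt_nonneg S
  have hss := CFC.sqrt_mul_sqrt_self S
  set s := CFC.sqrt S
  obtain ⟨g, hg0, hgc, hsgs⟩ := ContinuousLinearMap.exists_pseudoinverse hs0
  have hs := hs0.isSelfAdjoint
  have hg := hg0.isSelfAdjoint
  have hAP : ∀ i, A i * g * s = A i := by
    intro i
    have := mul_eq_zero_of_sum_star_mul_self_mul_eq_zero (Y := A) (Q := 1 - g * s) (by
      rw [hSA, ← hss, mul_sub, mul_one, hgc]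
      simp only [mul_assoc] at hsgs ⊢
      rw [← hgc, hsgs, sub_self]) i
    rw [mul_sub, mul_one, sub_eq_zero] at this
    rw [mul_assoc, ← this]
  -- With `s = S^{1/2}` and `g = s⁻¹`, the pairing of `X` with `A` equals that of `X s` with `A g`,
  -- and both of these columns have squared Hilbert–Schmidt norm at most `Tr S`.
  have h := two_mul_sum_opTr_star_mul_le Finset.univ (fun i => X i * s) (fun i => A i * g)
  have h1 : ∑ i, opTr (star (X i * s) * (A i * g)) = ∑ i, opTr (star (X i) * A i) := by
    refine Finset.sum_congr rfl fun i _ => ?_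
    rw [star_mul, hs.star_eq, mul_assoc, opTr_mul_comm, mul_assoc, hAP]
  have h2 : ∑ i, opTr (star (X i * s) * (X i * s)) ≤ opTr S := by
    have : ∑ i, star (X i * s) * (X i * s) = s * (∑ i, star (X i) * X i) * s := by
      simp only [Finset.sum_mul, Finset.mul_sum, star_mul, mul_assoc, hs.star_eq]
    rw [← opTr_sum, this]
    refine opTr_mono ((hs.conjugate_le_conjugate hX).trans_eq ?_)
    rw [mul_one, hss]
  have h3 : ∑ i, opTr (star (A i * g) * (A i * g)) = opTr S := by
    have : ∑ i, star (A i * g) * (A i * g) = g * (∑ i, star (A i) * A i) * g := by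
      simp only [Finset.sum_mul, Finset.mul_sum, star_mul, mul_assoc, hg.star_eq]
    rw [← opTr_sum, this, hSA, ← hss]
    have : g * (s * s * (s * s)) * g = (s * g * s) * (s * g * s) := by
      calc g * (s * s * (s * s)) * g = (g * s) * (s * s) * (s * g) := by simp only [mul_assoc]
        _ = (s * g) * (s * s) * (g * s) := by rw [hgc]
        _ = _ := by simp only [mul_assoc]
    rw [this, hsgs]
  simp only [h1, h3] at h
  linarith

/-- Here `c i = A_i^{1/8}` and `e = E^{1/4}`: with these roots every factor in the two
Cauchy–Schwarz steps is a natural power. -/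
theorem pow_three_sum_opTr_le {ι : Type*} [Fintype ι] {c : ι → H →L[ℂ] H} {e S : H →L[ℂ] H}
    (hc : ∀ i, 0 ≤ c i) (he : 0 ≤ e) (hec : ∑ i, c i ^ 4 = e ^ 4) (hS : 0 ≤ S)
    (hSc : ∑ i, c i ^ 16 = S ^ 2) :
    (∑ i, opTr (c i ^ 8)) ^ 3 ≤ opTr S ^ 2 * opTr (e ^ 4 * e ^ 4) := by
  obtain ⟨f, hf0, hfc, hefe⟩ := ContinuousLinearMap.exists_pseudoinverse he
  have hes := he.isSelfAdjoint
  have hfs := hf0.isSelfAdjoint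
  have hproj := hes.mul_pseudoinverse_isStarProjection hfs hfc hefe
  have hcs := fun i => (hc i).isSelfAdjoint
  have hcp := fun i (n : ℕ) => ((hcs i).pow n).star_eq
  have hcP : ∀ i, c i ^ 2 * (e * f) = c i ^ 2 := by
    intro i
    have := mul_eq_zero_of_sum_star_mul_self_mul_eq_zero (Y := fun i => c i ^ 2)
      (Q := 1 - e * f) (by
        simp only [hcp, ← pow_add]
        rw [hec, mul_sub, mul_one, pow_succ, mul_assoc (e ^ 3), ← hfc, ← mul_assoc e, hefe,
          sub_self]) i
    rw [mul_sub, mul_one, sub_eq_zero] at this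
    exact this.symm
  have hF1 : ∑ i, opTr (f ^ 2 * c i ^ 10) ≤ opTr S := by
    -- The squares of the column `c i ^ 2 * f ^ 2` sum to `f² e⁴ f²`, the support projection of `e`.
    have := sum_opTr_star_mul_le_opTr_of_sum_star_mul_self_le_one (A := fun i => c i ^ 8)
      (X := fun i => c i ^ 2 * f ^ 2) hS (by simp only [hcp, ← pow_add, hSc, ← pow_two S]) (by
        have h1 : ∑ i, star (c i ^ 2 * f ^ 2) * (c i ^ 2 * f ^ 2) =
            f ^ 2 * (∑ i, c i ^ 4) * f ^ 2 := by
          rw [Finset.mul_sum, Finset.sum_mul]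
          refine Finset.sum_congr rfl fun i _ => ?_
          rw [star_mul, hcp, (hfs.pow 2).star_eq, show 4 = 2 + 2 from rfl, pow_add]
          simp only [mul_assoc]
        have hcomm : Commute f e := hfc
        have h2 : f ^ 2 * e ^ 4 * f ^ 2 = e * f := by
          rw [(hcomm.pow_pow 2 4).eq, mul_assoc, ← pow_add, ← hcomm.symm.mul_pow]
          exact hproj.isIdempotentElem.pow_succ_eq 3
        rw [h1, hec, h2]
        exact hproj.le_one)
    refine le_of_eq_of_le (Finset.sum_congr rfl fun i _ => ?_) this
    rw [star_mul, hcp, (hfs.pow 2).star_eq, mul_assoc, ← pow_add]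
  have hC1 := sq_sum_opTr_star_mul_le Finset.univ (fun i => c i ^ 5 * f) (fun i => c i ^ 3 * e)
  have hC2 := sq_sum_opTr_star_mul_le Finset.univ (fun i => c i ^ 4) (fun i => c i ^ 2 * e ^ 2)
  have hF1n : 0 ≤ ∑ i, opTr (star (c i ^ 5 * f) * (c i ^ 5 * f)) :=
    Finset.sum_nonneg fun i _ => opTr_nonneg (star_mul_self_nonneg _)
  have hFn : 0 ≤ ∑ i, opTr (star (c i ^ 3 * e) * (c i ^ 3 * e)) :=
    Finset.sum_nonneg fun i _ => opTr_nonneg (star_mul_self_nonneg _)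
  have hF0n : 0 ≤ ∑ i, opTr (star (c i ^ 4) * c i ^ 4) :=
    Finset.sum_nonneg fun i _ => opTr_nonneg (star_mul_self_nonneg _)
  have e1 : ∀ i, opTr (star (c i ^ 5 * f) * (c i ^ 5 * f)) = opTr (f ^ 2 * c i ^ 10) := by
    intro i
    rw [star_mul, hcp, hfs.star_eq, mul_assoc, ← mul_assoc (c i ^ 5), ← pow_add, ← mul_assoc,
      opTr_mul_comm, ← mul_assoc, ← pow_two]
  have e2 : ∀ i, opTr (star (c i ^ 5 * f) * (c i ^ 3 * e)) = opTr (c i ^ 8) := by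
    intro i
    rw [star_mul, hcp, hfs.star_eq, mul_assoc, ← mul_assoc (c i ^ 5), ← pow_add, opTr_mul_comm,
      mul_assoc, show 5 + 3 = 6 + 2 from rfl, pow_add, mul_assoc, hcP, ← pow_add]
  have e3 : ∀ i, opTr (star (c i ^ 3 * e) * (c i ^ 3 * e)) = opTr (c i ^ 6 * e ^ 2) := by
    intro i
    rw [star_mul, hcp, hes.star_eq, mul_assoc, ← mul_assoc (c i ^ 3), ← pow_add, opTr_mul_comm,
      mul_assoc, ← pow_two]
  have e4 : ∀ i, opTr (star (c i ^ 4) * (c i ^ 2 * e ^ 2)) = opTr (c i ^ 6 * e ^ 2) := by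
    intro i
    rw [hcp, ← mul_assoc, ← pow_add]
  have e5 : ∀ i, opTr (star (c i ^ 4) * c i ^ 4) = opTr (c i ^ 8) := by
    intro i
    rw [hcp, ← pow_add]
  have e6 : ∑ i, opTr (star (c i ^ 2 * e ^ 2) * (c i ^ 2 * e ^ 2)) = opTr (e ^ 4 * e ^ 4) := by
    rw [← hec, Finset.sum_mul, opTr_sum, hec]
    refine Finset.sum_congr rfl fun i _ => ?_
    rw [star_mul, hcp, (hes.pow 2).star_eq, mul_assoc, ← mul_assoc (c i ^ 2), ← pow_add,
      opTr_mul_comm, mul_assoc, ← pow_add]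
  have hK : 0 ≤ opTr (e ^ 4 * e ^ 4) :=
    e6 ▸ Finset.sum_nonneg fun i _ => opTr_nonneg (star_mul_self_nonneg _)
  simp only [e1, e2, e3, e4, e5, e6] at hC1 hC2 hF1n hFn hF0n
  generalize ∑ i, opTr (c i ^ 8) = F0 at *
  generalize ∑ i, opTr (f ^ 2 * c i ^ 10) = F1 at *
  generalize ∑ i, opTr (c i ^ 6 * e ^ 2) = F2 at *
  generalize opTr (e ^ 4 * e ^ 4) = K at *
  generalize opTr S = t at *
  rcases hF0n.eq_or_lt with h0 | h0
  · rw [← h0, zero_pow three_ne_zero]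
    exact mul_nonneg (sq_nonneg _) hK
  · have h1 : F0 * F0 ^ 3 ≤ F0 * (F1 ^ 2 * K) :=
      calc F0 * F0 ^ 3 = (F0 ^ 2) ^ 2 := by ring
        _ ≤ (F1 * F2) ^ 2 := by gcongr
        _ = F1 ^ 2 * F2 ^ 2 := by ring
        _ ≤ F1 ^ 2 * (F0 * K) := by gcongr
        _ = F0 * (F1 ^ 2 * K) := by ring
    exact (le_of_mul_le_mul_left h1 h0).trans (by gcongr)

/-- `A X* X A ≤ A²`, and the square root is operator monotone. -/
theorem traceNorm_mul_le_opTr {A X : H →L[ℂ] H} (hA : 0 ≤ A) (hX : star X * X ≤ 1) :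
    traceNorm (X * A) ≤ opTr A := by
  refine opTr_mono ?_
  refine (CFC.sqrt_le_sqrt _ (A * A) ?_).trans_eq (CFC.sqrt_mul_self A)
  have h := hA.isSelfAdjoint.conjugate_le_conjugate hX
  rw [mul_one] at h
  rw [star_mul, hA.isSelfAdjoint.star_eq]
  simpa only [mul_assoc] using h

theorem tysonGammaStar_le_tysonGamma {r : ℕ} {A X : Fin r → H →L[ℂ] H} (hA : ∀ i, 0 ≤ A i)
    (hX : ∑ k, star (X k) * X k = 1) : tysonGammaStar A ≤ tysonGamma A X := by
  refine csInf_le ⟨0, ?_⟩ ⟨X, hX, rfl⟩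
  rintro _ ⟨Y, hY, rfl⟩
  rw [tysonGamma, opTr_sum, sub_nonneg]
  refine Finset.sum_le_sum fun k _ => traceNorm_mul_le_opTr (hA k) ?_
  rw [← hY]
  exact Finset.single_le_sum (f := fun k => star (Y k) * Y k)
    (fun i _ => star_mul_self_nonneg _) (Finset.mem_univ k)

theorem tysonGammaStar_le {r : ℕ} {A : Fin r → H →L[ℂ] H} (hA : ∀ i, 0 ≤ A i)
    {S : H →L[ℂ] H} (hS : 0 ≤ S) (hSA : ∑ i, A i ^ 2 = S ^ 2) :
    tysonGammaStar A ≤ opTr (∑ j, A j) - opTr S := by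
  rcases r with _ | r
  -- For `r = 0` the constraint reads `0 = 1`: the set of values is empty unless `H` is trivial, and
  -- `sInf ∅ = 0`.
  · have hS0 : S = 0 := by
      have : star S * S = 0 := by
        rw [hS.isSelfAdjoint.star_eq, ← pow_two, ← hSA]; simp
      exact CStarRing.star_mul_self_eq_zero_iff _ |>.1 this
    have hset : {g : ℝ | ∃ X : Fin 0 → H →L[ℂ] H,
        ∑ k, star (X k) * X k = 1 ∧ g = tysonGamma A X} ⊆ {0} := by
      rintro _ ⟨X, -, rfl⟩
      simp [tysonGamma, opTr_zero]
    rw [tysonGammaStar, hS0]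
    rcases Set.subset_singleton_iff_eq.1 hset with h | h <;> rw [h] <;> simp [opTr_zero]
  · obtain ⟨f, hf0, hfc, hSfS⟩ := ContinuousLinearMap.exists_pseudoinverse hS
    have hSs := hS.isSelfAdjoint
    have hfs := hf0.isSelfAdjoint
    have hAs := fun i => (hA i).isSelfAdjoint
    have hproj := hSs.mul_pseudoinverse_isStarProjection hfs hfc hSfS
    set Q := 1 - S * f with hQ
    have hQp : IsStarProjection Q := hproj.one_sub
    have hAQ : ∀ i, A i * Q = 0 := mul_eq_zero_of_sum_star_mul_self_mul_eq_zero (by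
      simp only [(hAs _).star_eq, ← pow_two, hSA]
      rw [hQ, mul_sub, mul_one, pow_two, mul_assoc, ← mul_assoc S S f, mul_assoc S S f, ← hfc,
        ← mul_assoc S f S, hSfS, sub_self])
    have hQA : ∀ i, Q * A i = 0 := fun i => by
      have := congrArg star (hAQ i)
      rwa [star_mul, hQp.isSelfAdjoint.star_eq, (hAs i).star_eq, star_zero] at this
    have hsum : ∑ k, f * A k ^ 2 * f = S * f := by
      rw [← Finset.sum_mul, ← Finset.mul_sum, hSA, pow_two, ← mul_assoc, hfc, mul_assoc,
        hproj.isIdempotentElem.eq]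
    -- `Q` completes the sum to the identity on `ker S`; since `Q * A k = 0`, it does not change `X
    -- k * A k`.
    let X : Fin (r + 1) → H →L[ℂ] H := fun k => A k * f + if k = 0 then Q else 0
    have hX : ∑ k, star (X k) * X k = 1 := by
      have : ∀ k, star (X k) * X k = f * A k ^ 2 * f + if k = 0 then Q else 0 := by
        intro k
        have h1 : f * A k * (A k * f) = f * A k ^ 2 * f := by simp only [pow_two, mul_assoc]
        by_cases hk : k = 0
        · simp only [X, hk, if_true, star_add, star_mul, hfs.star_eq, (hAs _).star_eq,
            hQp.isSelfAdjoint.star_eq, add_mul, mul_add, hQp.isIdempotentElem.eq]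
          rw [hk] at h1
          rw [h1, mul_assoc f (A 0) Q, hAQ, ← mul_assoc Q, hQA]
          simp
        · simp only [X, hk, if_false, add_zero, star_mul, hfs.star_eq, (hAs _).star_eq, h1]
      simp only [this, Finset.sum_add_distrib, hsum]
      simp [hQ]
    refine (tysonGammaStar_le_tysonGamma hA hX).trans_eq ?_
    have hXA : ∀ k, traceNorm (X k * A k) = opTr (A k ^ 2 * f) := by
      intro k
      have h1 : X k * A k = A k * f * A k := by
        by_cases hk : k = 0
        · simp only [X, hk, if_true, add_mul, hQA, add_zero]
        · simp only [X, hk, if_false, add_zero]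
      rw [h1, traceNorm, CFC.abs_of_nonneg _ ((hAs k).conjugate_nonneg hf0), mul_assoc,
        opTr_mul_comm, mul_assoc, ← pow_two, opTr_mul_comm]
    rw [tysonGamma]
    simp only [hXA]
    rw [← opTr_sum, ← Finset.sum_mul, hSA, pow_two, mul_assoc, ← hfc, ← mul_assoc, hSfS]

theorem pairOverlap_nonneg {r : ℕ} (A : Fin r → H →L[ℂ] H) : 0 ≤ pairOverlap A :=
  Finset.sum_nonneg fun _ _ => Finset.sum_nonneg fun _ _ =>
    opTr_mul_nonneg CFC.rpow_nonneg CFC.rpow_nonneg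

end Tyson

/-! ### Real inequalities and conclusion. -/

theorem sq_rpow_mul_rpow_neg_half {t K : ℝ} (ht : 0 ≤ t) (hK : 0 ≤ K) :
    (t ^ (3 / 2 : ℝ) * K ^ (-(1 / 2) : ℝ)) ^ 2 = t ^ 3 * K⁻¹ := by
  rw [mul_pow, ← Real.rpow_natCast, ← Real.rpow_natCast, ← Real.rpow_mul ht,
    ← Real.rpow_mul hK, ← Real.rpow_natCast, ← Real.rpow_neg_one]
  norm_num

theorem rpow_mul_rpow_neg_half_le {t K s : ℝ} (ht : 0 ≤ t) (hK : 0 ≤ K) (hs : 0 ≤ s)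
    (h : t ^ 3 ≤ s ^ 2 * K) : t ^ (3 / 2 : ℝ) * K ^ (-(1 / 2) : ℝ) ≤ s := by
  rw [← pow_le_pow_iff_left₀ (by positivity) hs two_ne_zero, sq_rpow_mul_rpow_neg_half ht hK]
  exact div_le_of_le_mul₀ hK (sq_nonneg s) h

theorem sub_rpow_mul_rpow_neg_half_le {t p : ℝ} (ht : 0 ≤ t) (hp : 0 ≤ p) :
    t - t ^ (3 / 2 : ℝ) * (t + 2 * p) ^ (-(1 / 2) : ℝ) ≤ p := by
  have hK : 0 ≤ t + 2 * p := by positivity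
  have h0 : 0 ≤ t ^ (3 / 2 : ℝ) * (t + 2 * p) ^ (-(1 / 2) : ℝ) := by positivity
  rcases le_or_gt t p with htp | htp
  · linarith
  · rw [sub_le_comm, ← pow_le_pow_iff_left₀ (sub_nonneg.2 htp.le) h0 two_ne_zero,
      sq_rpow_mul_rpow_neg_half ht hK, ← div_eq_mul_inv, le_div_iff₀ (by linarith)]
    -- `(t - p)² (t + 2p) = t³ - p² (2(t - p) + t)`.
    nlinarith [mul_nonneg (sq_nonneg p) (sub_nonneg.2 htp.le), mul_nonneg (sq_nonneg p) ht]

theorem mainTheorem9 {H : Type*} [NormedAddCommGroup H] [InnerProductSpace ℂ H]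
    [FiniteDimensional ℂ H] [CompleteSpace H] {r : ℕ} (A : Fin r → H →L[ℂ] H)
    (hA : ∀ i, (A i).IsPositive) :
    tysonGammaStar A ≤ opTr (∑ j, A j) - opTr ((∑ j, A j ^ 2) ^ (1 / 2 : ℝ)) ∧
    opTr (∑ j, A j) - opTr ((∑ j, A j ^ 2) ^ (1 / 2 : ℝ)) ≤
      opTr (∑ j, A j) - opTr (∑ j, A j) ^ (3 / 2 : ℝ) *
        (opTr (∑ j, A j) + 2 * pairOverlap A) ^ (-(1 / 2) : ℝ) ∧
    opTr (∑ j, A j) - opTr (∑ j, A j) ^ (3 / 2 : ℝ) *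
        (opTr (∑ j, A j) + 2 * pairOverlap A) ^ (-(1 / 2) : ℝ) ≤
      pairOverlap A := by
  have hA0 : ∀ i, 0 ≤ A i := fun i => (ContinuousLinearMap.nonneg_iff_isPositive _).2 (hA i)
  have ht : 0 ≤ opTr (∑ j, A j) := opTr_nonneg (Finset.sum_nonneg fun i _ => hA0 i)
  have hp := pairOverlap_nonneg A
  have hT : 0 ≤ ∑ j, A j ^ 2 :=
    Finset.sum_nonneg fun i _ => (hA0 i).isSelfAdjoint.sq_nonneg
  have hS : (0 : H →L[ℂ] H) ≤ (∑ j, A j ^ 2) ^ (1 / 2 : ℝ) := CFC.rpow_nonneg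
  have hSA : ((∑ j, A j ^ 2) ^ (1 / 2 : ℝ)) ^ 2 = ∑ j, A j ^ 2 := by
    exact_mod_cast rpow_one_div_pow hT two_ne_zero
  refine ⟨tysonGammaStar_le hA0 hS hSA.symm, sub_le_sub_left ?_ _,
    sub_rpow_mul_rpow_neg_half_le ht hp⟩
  refine rpow_mul_rpow_neg_half_le ht (by positivity) (opTr_nonneg hS) ?_
  have hE : 0 ≤ ∑ i, A i ^ (1 / 2 : ℝ) := Finset.sum_nonneg fun i _ => CFC.rpow_nonneg
  have hc8 : ∀ i, (A i ^ (1 / (8 : ℕ) : ℝ)) ^ 8 = A i := fun i =>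
    rpow_one_div_pow (hA0 i) (by norm_num)
  have hc4 : ∀ i, (A i ^ (1 / (8 : ℕ) : ℝ)) ^ 4 = A i ^ (1 / 2 : ℝ) := fun i => by
    rw [← CFC.rpow_natCast _ _ CFC.rpow_nonneg,
      CFC.rpow_rpow_of_exponent_nonneg _ _ _ (by positivity) (by positivity) (hA0 i)]
    norm_num
  have he := rpow_one_div_pow hE (n := 4) (by norm_num)
  have h := pow_three_sum_opTr_le (c := fun i => A i ^ (1 / (8 : ℕ) : ℝ))
    (fun i => CFC.rpow_nonneg) CFC.rpow_nonneg (by simp only [hc4]; exact he.symm) hS (by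
      rw [hSA]
      refine Finset.sum_congr rfl fun i _ => ?_
      rw [show 16 = 8 * 2 from rfl, pow_mul, hc8])
  simp only [hc8, he] at h
  rwa [opTr_sq_sum_rpow_half hA0, ← opTr_sum] at h
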